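/- Consider single-parameter environments with $n$ agents. Each agent $i$ has a private valuation $v_i\in\{l_n,h_n\}$, where $0<l_n<h_n$ and the ratio $h_n/l_n=\rho$ does not depend on $n$. Amounts of stuff are taken from a fixed set $Q\subseteq[0,\infty)$ that contains $0$ and some positive number (for instance $Q=\{0,1\}$ or $Q=[0,\infty)$). An allocation is a vector $x\in Q^n$, its welfare at $v$ is $\sum_i v_ix_i$, and the feasibility set $\mathcal F\subseteq Q^n$ is downward-closed (if $x\in\mathcal F$, $y\in Q^n$ and $y\le x$ coordinatewise, then $y\in\mathcal F$). An algorithm for $\mathcal F$ is a function $\mathcal A:\{l_n,h_n\}^n\to\mathcal F$. A (randomized, adaptive, black-box) transformation $\mathcal T$ receives $n$ and a valuation vector $v$. In each step it flips a fair coin, queries $\mathcal A$ at a valuation vector of its choice, or asks whether an allocation of its choice belongs to $\mathcal F$, where its choices may depend on all previous answers; finally it returns an allocation $\mathcal T(\mathcal A)(v)$, which must belong to $\mathcal F$. Say that $\mathcal T$ - makes polynomially many steps if, for some polynomial $p$, it never makes more than $p(n)$ coin flips and queries (computation between these steps is not restricted, so every polynomial-time transformation is included); - is monotone if, for all $n$,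 $\mathcal F$, $\mathcal A$, whenever one agent's valuation increases and the others stay fixed, the expected amount that $\mathcal T(\mathcal A)$ gives to this agent does not decrease; - is constant-fraction welfare-preserving if there are a constant $c>0$ and $\delta_n\to0$ such that, for all $n$, $\mathcal F$, $\mathcal A$ and every input $v$, with probability at least $1-\delta_n$ the welfare of $\mathcal T(\mathcal A)(v)$ at $v$ is at least $c$ times the welfare of $\mathcal A(v)$ at $v$. Theorem. No transformation with polynomially many steps is both monotone and constant-fraction welfare-preserving. In particular, there is no polynomial-time, monotone, constant-fraction welfare-preserving transformation, even if the transformation may be randomized and adaptive and may make polynomially many queries to $\mathcal F$. -/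

import Mathlib

/-!
Single-parameter environments with `n` agents.  The set `V` holds the possible private valuations
and the set `Q` the possible amounts of stuff (for instance `{0, 1}` or `[0, ∞)`).  A valuation
vector is a function `Fin n → V`, an allocation a function `Fin n → Q`, and a feasibility set a
set of allocations.
-/

/-- The welfare `v₁ x₁ + ⋯ + vₙ xₙ` of the allocation `x` at the valuation vector `v`. -/
def welfare {V Q : Set ℝ} {n : ℕ} (v : Fin n → V) (x : Fin n → Q) : ℝ :=
  ∑ i, (v i : ℝ) * (x i : ℝ)

/-- A downward-closed environment together with an algorithm (allocation rule) for it: a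
downward-closed feasibility set, and a function that maps each valuation vector to a feasible
allocation. -/
structure Instance (V Q : Set ℝ) (n : ℕ) where
  /-- the feasibility set -/
  feas : Set (Fin n → Q)
  /-- decreasing the amounts given to agents preserves feasibility -/
  downward_closed : IsLowerSet feas
  /-- the algorithm -/
  alg : (Fin n → V) → (Fin n → Q)
  /-- the algorithm returns feasible allocations -/
  alg_mem : ∀ v, alg v ∈ feas

/-- A randomized adaptive procedure with black-box access to an algorithm and to a feasibility
set.  At each step it flips a fair coin, asks for the allocation that the algorithm returns at some
valuation vector, or asks whether some allocation is feasible; how it goes on may depend in an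
arbitrary way on all the answers so far.  At the end it returns an allocation. -/
inductive Procedure (V Q : Set ℝ) (n : ℕ) : Type
  | ret (x : Fin n → Q) : Procedure V Q n
  | coin (next : Bool → Procedure V Q n) : Procedure V Q n
  | queryAlg (v : Fin n → V) (next : (Fin n → Q) → Procedure V Q n) : Procedure V Q n
  | queryFeas (x : Fin n → Q) (next : Bool → Procedure V Q n) : Procedure V Q n

namespace Procedure

variable {V Q : Set ℝ} {n : ℕ}

open Classical in
/-- The largest number of steps (coin flips and queries) of a run, over all coin outcomes, when the
queries are answered according to `I`. -/
noncomputable def steps (I : Instance V Q n) : Procedure V Q n → ℕ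
  | ret _ => 0
  | coin next => 1 + max (steps I (next true)) (steps I (next false))
  | queryAlg v next => 1 + steps I (next (I.alg v))
  | queryFeas x next => 1 + steps I (next (decide (x ∈ I.feas)))

open Classical in
/-- The expectation, over the coin flips, of `f` at the returned allocation, when the queries are
answered according to `I`. -/
noncomputable def expect (I : Instance V Q n) (f : (Fin n → Q) → ℝ) : Procedure V Q n → ℝ
  | ret x => f x
  | coin next => (expect I f (next true) + expect I f (next false)) / 2
  | queryAlg v next => expect I f (next (I.alg v))
  | queryFeas x next => expect I f (next (decide (x ∈ I.feas)))

/-- The probability, over the coin flips, that the returned allocation lies in `S`, when the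
queries are answered according to `I`. -/
noncomputable def prob (I : Instance V Q n) (S : Set (Fin n → Q)) (P : Procedure V Q n) : ℝ :=
  P.expect I (S.indicator 1)

end Procedure

/-- A (randomized, adaptive) black-box transformation: for each number `n` of agents and each
valuation vector, a procedure with access to the algorithm and to the feasibility set.  With `n`
agents the possible valuations are the elements of `V n`. -/
def Transformation (V : ℕ → Set ℝ) (Q : Set ℝ) : Type :=
  ∀ n : ℕ, (Fin n → V n) → Procedure (V n) Q n

namespace Transformation

variable {V : ℕ → Set ℝ} {Q : Set ℝ}

/-- For every algorithm and every downward-closed environment, the transformation always returns a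
feasible allocation. -/
def IsFeasible (T : Transformation V Q) : Prop :=
  ∀ (n : ℕ) (I : Instance (V n) Q n) (v : Fin n → V n), (T n v).prob I I.feas = 1

/-- The number of steps (coin flips, queries to the algorithm, and queries to the feasibility set)
is bounded by a polynomial in `n`.  Computation between the steps is free, and the procedures for
different `n` need not be related, so every polynomial-time transformation has this property. -/
def IsPolynomial (T : Transformation V Q) : Prop :=
  ∃ p : Polynomial ℕ, ∀ (n : ℕ) (I : Instance (V n) Q n) (v : Fin n → V n),
    (T n v).steps I ≤ p.eval n

/-- Monotonicity: for every algorithm, if one agent increases its valuation and the others keep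
theirs, then the (expected) amount that this agent is given does not decrease. -/
def IsMonotone (T : Transformation V Q) : Prop :=
  ∀ (n : ℕ) (I : Instance (V n) Q n) (v : Fin n → V n) (i : Fin n) (b : V n), v i ≤ b →
    (T n v).expect I (fun x => (x i : ℝ)) ≤
      (T n (Function.update v i b)).expect I (fun x => (x i : ℝ))

/-- There is a constant `c > 0` such that for every algorithm, at every input, the transformation
achieves at least a fraction `c` of the welfare of the algorithm at that input, except with a
probability `δ n` that tends to `0` as the number `n` of agents grows.  For a deterministic
transformation this means that, for all large `n`, the fraction is achieved at every input. -/
def PreservesConstantFraction (T : Transformation V Q) : Prop :=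
  ∃ c : ℝ, 0 < c ∧ ∃ δ : ℕ → ℝ, Filter.Tendsto δ Filter.atTop (nhds 0) ∧
    ∀ (n : ℕ) (I : Instance (V n) Q n) (v : Fin n → V n),
      1 - δ n ≤ (T n v).prob I {x | c * welfare v (I.alg v) ≤ welfare v x}

end Transformation

/-!
The proof exhibits environments in which a monotone transformation would have to know something
that it cannot find with polynomially many queries.

Fix `s` larger than the degree of the polynomial that bounds the number of steps, and numbers
`k` and `r` that depend on `s`, `ρ` and the welfare fraction `c` but not on the number of agents.
There are `k` decoy agents `P` and `r` blocks of `b` agents each, with `b → ∞`. A secret set `R`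
contains one agent of each block, and a secret set `W` of agents is disjoint from `R`. The algorithm
serves `P`, except that it serves `R` when precisely the agents in `W` have the high valuation. An
allocation is feasible if it gives nobody more than a fixed amount `q > 0` and serves only agents in
`P`, or only agents in `R`, or at most `s` agents (`hiddenInstance`). Call it revealing if it serves only agents in `R` and serves many of them
(`revealing`).

*Monotonicity forces revealing allocations.* At `W` the welfare guarantee can be met only by a
revealing allocation, because `R` is much larger than `P`. If revealing allocations have probability
`g` at the high set `W ∪ U` with `U ⊆ R` and `#U ≤ s`, then some `u ∈ R \ U` receives an amount of at
least `g * q / #R` in expectation, hence also at `W ∪ insert u U`. There the guarantee is that of the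
decoy `P`, and a feasible allocation that serves `u ∉ P` and attains it must again be revealing. So
the probability drops only by the constant factor `1 / r` and an error `δ`
(`exists_insert_prob_revealing`), and after `s` steps it is still bounded below by a positive
constant (`exists_subset_prob_revealing`).

*Revealing allocations cannot be found.* Given only the set `A = W ∪ U`, where `#U = s`, a query
tells the instance apart from the one that hides nothing only if it is at the valuation vector of
`W`, which determines `U`, or at an allocation that serves more than `s` agents, all of them in `R`.
For random secrets either has probability of order `b ^ (-s)` at most, and so a procedure with `N`
steps returns a revealing allocation with probability of order `N * b ^ (-s)` at most
(`Procedure.sum_prob_le`, `sum_prob_revealing_le`).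

Averaging over the secrets (`mul_pow_le_of_monotone`) and letting `b → ∞` gives a contradiction,
since `N` is bounded by a polynomial in `b` of degree less than `s`.
-/

open Finset

/-! ### Expectations and probabilities of procedures -/

namespace Procedure

variable {V Q : Set ℝ} {n : ℕ} (I : Instance V Q n)

theorem expect_const (c : ℝ) (P : Procedure V Q n) : P.expect I (fun _ => c) = c := by
  induction P with
  | ret x => rfl
  | coin next ih => simp only [expect, ih]; ring
  | queryAlg v next ih => simp only [expect, ih]
  | queryFeas x next ih => simp only [expect, ih]

theorem expect_add (f g : (Fin n → Q) → ℝ) (P : Procedure V Q n) :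
    P.expect I (fun x => f x + g x) = P.expect I f + P.expect I g := by
  induction P with
  | ret x => rfl
  | coin next ih => simp only [expect, ih]; ring
  | queryAlg v next ih => simp only [expect, ih]
  | queryFeas x next ih => simp only [expect, ih]

theorem expect_const_mul (c : ℝ) (f : (Fin n → Q) → ℝ) (P : Procedure V Q n) :
    P.expect I (fun x => c * f x) = c * P.expect I f := by
  induction P with
  | ret x => rfl
  | coin next ih => simp only [expect, ih]; ring
  | queryAlg v next ih => simp only [expect, ih]
  | queryFeas x next ih => simp only [expect, ih]

theorem expect_sum {ι : Type*} (s : Finset ι) (f : ι → (Fin n → Q) → ℝ) (P : Procedure V Q n) :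
    P.expect I (fun x => ∑ i ∈ s, f i x) = ∑ i ∈ s, P.expect I (f i) := by
  classical
  induction s using Finset.induction_on with
  | empty => simpa using expect_const I 0 P
  | insert a s ha ih => simp only [Finset.sum_insert ha, expect_add, ih]

theorem expect_mono {f g : (Fin n → Q) → ℝ} (h : ∀ x, f x ≤ g x) (P : Procedure V Q n) :
    P.expect I f ≤ P.expect I g := by
  induction P with
  | ret x => exact h x
  | coin next ih => simp only [expect]; linarith [ih true, ih false]
  | queryAlg v next ih => exact ih _
  | queryFeas x next ih => exact ih _

theorem prob_nonneg (S : Set (Fin n → Q)) (P : Procedure V Q n) : 0 ≤ P.prob I S := by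
  rw [← expect_const I 0 P]
  exact expect_mono I (fun x => Set.indicator_nonneg (fun _ _ => zero_le_one) x) P

theorem prob_le_one (S : Set (Fin n → Q)) (P : Procedure V Q n) : P.prob I S ≤ 1 := by
  rw [← expect_const I 1 P]
  exact expect_mono I (fun x => Set.indicator_le_self' (fun _ _ => zero_le_one) x) P

/-- If the returned allocation lies in `S` almost surely, then expectations are monotone with
respect to the pointwise order on `S`. -/
theorem expect_mono_of_prob_eq_one {S : Set (Fin n → Q)} {f g : (Fin n → Q) → ℝ}
    (h : ∀ x ∈ S, f x ≤ g x) (P : Procedure V Q n) (hP : P.prob I S = 1) :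
    P.expect I f ≤ P.expect I g := by
  induction P with
  | ret x =>
    refine h x ?_
    by_contra hx
    simp [prob, expect, hx] at hP
  | coin next ih =>
    have h1 := prob_le_one I S (next true)
    have h2 := prob_le_one I S (next false)
    have h3 : ((next true).prob I S + (next false).prob I S) / 2 = 1 := hP
    simp only [expect]
    linarith [ih true (by linarith), ih false (by linarith)]
  | queryAlg v next ih => exact ih _ hP
  | queryFeas x next ih => exact ih _ hP

/-- A needle-in-a-haystack bound. Each of the instances `I a` has its own set `good a` of
allocations. If every single query separates at most `M` of these instances from the reference
instance `I₀`, and every allocation is good for at most `M` of them, then a procedure with at most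
`N` steps on `I₀` returns good allocations with probabilities that add up to at most
`(N + 1) * M`. -/
theorem sum_prob_le {ι : Type*} (I₀ : Instance V Q n) (I : ι → Instance V Q n)
    (good : ι → Set (Fin n → Q)) {M : ℝ} (hM : 0 ≤ M) (P : Procedure V Q n) (A : Finset ι)
    (hgood : ∀ x, ∀ B ⊆ A, (∀ a ∈ B, x ∈ good a) → (#B : ℝ) ≤ M)
    (halg : ∀ v, ∀ B ⊆ A, (∀ a ∈ B, (I a).alg v ≠ I₀.alg v) → (#B : ℝ) ≤ M)
    (hfeas : ∀ x, ∀ B ⊆ A, (∀ a ∈ B, ¬ (x ∈ (I a).feas ↔ x ∈ I₀.feas)) → (#B : ℝ) ≤ M)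
    (N : ℕ) (hN : P.steps I₀ ≤ N) :
    ∑ a ∈ A, P.prob (I a) (good a) ≤ (N + 1) * M := by
  classical
  -- The instances separated by a query contribute at most `1` each.
  have key : ∀ (p : ι → Prop) [DecidablePred p] (A : Finset ι) (P : Procedure V Q n),
      (∀ B ⊆ A, (∀ a ∈ B, ¬ p a) → (#B : ℝ) ≤ M) →
      ∑ a ∈ A, P.prob (I a) (good a) ≤ M + ∑ a ∈ A with p a, P.prob (I a) (good a) := by
    intro p _ A P h
    rw [← Finset.sum_filter_add_sum_filter_not A p, add_comm]
    gcongr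
    calc ∑ a ∈ A with ¬ p a, P.prob (I a) (good a) ≤ ∑ a ∈ A with ¬ p a, (1 : ℝ) :=
          Finset.sum_le_sum fun a _ => prob_le_one _ _ _
      _ ≤ M := by
          simpa using h _ (Finset.filter_subset _ _) fun a ha => (Finset.mem_filter.1 ha).2
  induction P generalizing A N with
  | ret x =>
    have h := key (fun a => x ∉ good a) A (ret x) fun B hB h =>
      hgood x B hB fun a ha => not_not.1 (h a ha)
    have h0 : ∑ a ∈ A with x ∉ good a, (ret x : Procedure V Q n).prob (I a) (good a) = 0 :=
      Finset.sum_eq_zero fun a ha => by simp [prob, expect, (Finset.mem_filter.1 ha).2]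
    have : 0 ≤ (N : ℝ) * M := by positivity
    linarith
  | coin next ih =>
    simp only [steps] at hN
    obtain ⟨N, rfl⟩ : ∃ N', N = N' + 1 := ⟨N - 1, by omega⟩
    have h1 := ih true A hgood halg hfeas N (by omega)
    have h2 := ih false A hgood halg hfeas N (by omega)
    have h3 : ∑ a ∈ A, (coin next).prob (I a) (good a) =
        (∑ a ∈ A, (next true).prob (I a) (good a) +
          ∑ a ∈ A, (next false).prob (I a) (good a)) / 2 := by
      rw [← Finset.sum_add_distrib, Finset.sum_div]; rfl
    push_cast
    linarith
  | queryAlg v next ih =>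
    simp only [steps] at hN
    obtain ⟨N, rfl⟩ : ∃ N', N = N' + 1 := ⟨N - 1, by omega⟩
    have h := key (fun a => (I a).alg v = I₀.alg v) A (queryAlg v next) (halg v)
    have hs := Finset.filter_subset (fun a => (I a).alg v = I₀.alg v) A
    have h1 := ih (I₀.alg v) _ (fun x B hB => hgood x B (hB.trans hs))
      (fun x B hB => halg x B (hB.trans hs)) (fun x B hB => hfeas x B (hB.trans hs)) N (by omega)
    have h2 : ∑ a ∈ A with (I a).alg v = I₀.alg v, (queryAlg v next).prob (I a) (good a) =
        ∑ a ∈ A with (I a).alg v = I₀.alg v, (next (I₀.alg v)).prob (I a) (good a) :=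
      Finset.sum_congr rfl fun a ha => by
        rw [← (Finset.mem_filter.1 ha).2]; rfl
    push_cast
    linarith
  | queryFeas x next ih =>
    simp only [steps] at hN
    obtain ⟨N, rfl⟩ : ∃ N', N = N' + 1 := ⟨N - 1, by omega⟩
    have h := key (fun a => x ∈ (I a).feas ↔ x ∈ I₀.feas) A (queryFeas x next) (hfeas x)
    have hs := Finset.filter_subset (fun a => x ∈ (I a).feas ↔ x ∈ I₀.feas) A
    have h1 := ih (decide (x ∈ I₀.feas)) _ (fun x B hB => hgood x B (hB.trans hs))
      (fun x B hB => halg x B (hB.trans hs)) (fun x B hB => hfeas x B (hB.trans hs)) N (by omega)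
    have h2 : ∑ a ∈ A with (x ∈ (I a).feas ↔ x ∈ I₀.feas),
          (queryFeas x next).prob (I a) (good a) =
        ∑ a ∈ A with (x ∈ (I a).feas ↔ x ∈ I₀.feas),
          (next (decide (x ∈ I₀.feas))).prob (I a) (good a) :=
      Finset.sum_congr rfl fun a ha => by
        rw [← decide_eq_decide.2 (Finset.mem_filter.1 ha).2]; rfl
    push_cast
    linarith

end Procedure

/-! ### The hidden instances -/

section HiddenInstance

variable {l h q : ℝ} {Q : Set ℝ} {n : ℕ}

/-- The valuation vector at which exactly the agents in `A` have the high valuation `h`. -/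
def highOn (l h : ℝ) (A : Finset (Fin n)) : Fin n → ({l, h} : Set ℝ) :=
  fun i => if i ∈ A then ⟨h, by simp⟩ else ⟨l, by simp⟩

/-- The allocation that gives the amount `q` to the agents in `A` and nothing to the others. -/
def giveTo (h0 : (0 : ℝ) ∈ Q) (hq : q ∈ Q) (A : Finset (Fin n)) : Fin n → Q :=
  fun i => if i ∈ A then ⟨q, hq⟩ else ⟨0, h0⟩

open Classical in
/-- The set of agents that receive something. -/
noncomputable def served (x : Fin n → Q) : Finset (Fin n) := {i | (x i : ℝ) ≠ 0}

theorem mem_served {x : Fin n → Q} {i : Fin n} : i ∈ served x ↔ (x i : ℝ) ≠ 0 := by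
  simp [served]

theorem highOn_val (A : Finset (Fin n)) (i : Fin n) :
    (highOn l h A i : ℝ) = if i ∈ A then h else l := by
  unfold highOn; split_ifs <;> rfl

theorem giveTo_val (h0 : (0 : ℝ) ∈ Q) (hq : q ∈ Q) (A : Finset (Fin n)) (i : Fin n) :
    (giveTo h0 hq A i : ℝ) = if i ∈ A then q else 0 := by
  unfold giveTo; split_ifs <;> rfl

theorem served_giveTo_subset (h0 : (0 : ℝ) ∈ Q) (hq : q ∈ Q) (A : Finset (Fin n)) :
    served (giveTo h0 hq A) ⊆ A := by
  intro i hi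
  by_contra hA
  simp [mem_served, giveTo_val, hA] at hi

theorem highOn_injective (hlh : l < h) :
    Function.Injective (highOn l h : Finset (Fin n) → Fin n → ({l, h} : Set ℝ)) := by
  intro A B hAB
  ext i
  have := congrArg Subtype.val (congrFun hAB i)
  rw [highOn_val, highOn_val] at this
  split_ifs at this <;> simp_all

theorem highOn_insert (A : Finset (Fin n)) (u : Fin n) :
    highOn l h (insert u A) = Function.update (highOn l h A) u ⟨h, by simp⟩ := by
  ext i
  by_cases hi : i = u
  · subst hi; simp [highOn_val]
  · simp [highOn_val, hi]

open Classical in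
/-- The instance with secret agents `R`, secret high set `W` and decoy agents `P`. The algorithm
serves `R` at the valuation vector with high set `W`, and `P` at all other valuation vectors. No
agent can be given more than `q`, and an allocation is feasible if it serves only agents in `P`, or
only agents in `R`, or at most `s` agents. The last clause makes queries to the feasibility set at
small allocations useless. For `R = P` neither `R` nor `W` matters, and this is the reference
instance in which nothing is hidden. -/
noncomputable def hiddenInstance (hQ : ∀ a ∈ Q, 0 ≤ a) (h0 : (0 : ℝ) ∈ Q) (hq : q ∈ Q) (l h : ℝ)
    (s : ℕ) (P R W : Finset (Fin n)) : Instance {l, h} Q n where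
  feas := {x | (∀ i, (x i : ℝ) ≤ q) ∧ (served x ⊆ P ∨ served x ⊆ R ∨ #(served x) ≤ s)}
  downward_closed := by
    intro x y hyx hx
    have hsub : served y ⊆ served x := by
      intro i hi
      rw [mem_served] at hi ⊢
      have h1 : (y i : ℝ) ≤ x i := hyx i
      have h2 := hQ _ (y i).2
      exact fun h3 => hi (le_antisymm (h3 ▸ h1) h2)
    refine ⟨fun i => le_trans (hyx i) (hx.1 i), ?_⟩
    rcases hx.2 with h1 | h1 | h1
    · exact Or.inl (hsub.trans h1)
    · exact Or.inr (Or.inl (hsub.trans h1))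
    · exact Or.inr (Or.inr ((card_le_card hsub).trans h1))
  alg := fun v => if v = highOn l h W then giveTo h0 hq R else giveTo h0 hq P
  alg_mem := by
    have hle : ∀ (A : Finset (Fin n)) i, (giveTo h0 hq A i : ℝ) ≤ q := by
      intro A i
      rw [giveTo_val]
      split_ifs
      exacts [le_rfl, hQ q hq]
    intro v
    split_ifs
    · exact ⟨hle R, Or.inr (Or.inl (served_giveTo_subset h0 hq R))⟩
    · exact ⟨hle P, Or.inl (served_giveTo_subset h0 hq P)⟩

/-- The allocations that serve only agents in `R`, none of them with more than `q`, and whose total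
amount exceeds `s * q` by at least `q`. Exhibiting one reveals more than `s` of the agents in
`R`. -/
def revealing (q : ℝ) (s : ℕ) (R : Finset (Fin n)) : Set (Fin n → Q) :=
  {x | (∀ i, (x i : ℝ) ≤ q) ∧ served x ⊆ R ∧ (s + 1) * q ≤ ∑ i, (x i : ℝ)}

theorem sum_le_of_served_subset {x : Fin n → Q} {A : Finset (Fin n)} (hx : served x ⊆ A)
    (hle : ∀ i, (x i : ℝ) ≤ q) : ∑ i, (x i : ℝ) ≤ #A * q := by
  rw [← Finset.sum_subset (Finset.subset_univ A) fun i _ hi => by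
    by_contra h1; exact hi (hx (mem_served.2 h1))]
  simpa using Finset.sum_le_card_nsmul A (fun i => (x i : ℝ)) q fun i _ => hle i

theorem lt_card_served (hq : 0 < q) {s : ℕ} {R : Finset (Fin n)} {x : Fin n → Q}
    (hx : x ∈ revealing q s R) : s < #(served x) := by
  have h1 := hx.2.2.trans (sum_le_of_served_subset (Finset.Subset.refl _) hx.1)
  have h2 := le_of_mul_le_mul_right h1 hq
  exact_mod_cast h2

theorem welfare_le (hQ : ∀ a ∈ Q, 0 ≤ a) (hlh : l < h) (A : Finset (Fin n)) (x : Fin n → Q) :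
    welfare (highOn l h A) x ≤ h * ∑ i, (x i : ℝ) := by
  rw [welfare, Finset.mul_sum]
  refine Finset.sum_le_sum fun i _ => mul_le_mul_of_nonneg_right ?_ (hQ _ (x i).2)
  rw [highOn_val]; split_ifs
  exacts [le_rfl, hlh.le]

theorem le_welfare_giveTo (h0 : (0 : ℝ) ∈ Q) (hq : q ∈ Q) (hq0 : 0 < q) (hlh : l < h)
    (A B : Finset (Fin n)) : l * (#B * q) ≤ welfare (highOn l h A) (giveTo h0 hq B) := by
  have h1 : ∑ i, (giveTo h0 hq B i : ℝ) = #B * q := by simp [giveTo_val]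
  rw [← h1, welfare, Finset.mul_sum]
  refine Finset.sum_le_sum fun i _ => mul_le_mul_of_nonneg_right ?_ ?_
  · rw [highOn_val]; split_ifs
    exacts [hlh.le, le_rfl]
  · rw [giveTo_val]; split_ifs
    exacts [hq0.le, le_rfl]

/-- A feasible allocation that does not serve only decoys, and whose total amount is too large for
it to serve few agents, is revealing. -/
theorem mem_revealing {hQ : ∀ a ∈ Q, 0 ≤ a} {h0 : (0 : ℝ) ∈ Q} {hq : q ∈ Q} (hq0 : 0 < q) {s : ℕ}
    {P R W : Finset (Fin n)} {x : Fin n → Q}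
    (hx : x ∈ (hiddenInstance hQ h0 hq l h s P R W).feas) (hP : ¬ served x ⊆ P)
    (hsum : (s + 1) * q ≤ ∑ i, (x i : ℝ)) : x ∈ revealing q s R := by
  refine ⟨hx.1, ?_, hsum⟩
  rcases hx.2 with h1 | h1 | h1
  · exact absurd h1 hP
  · exact h1
  · have h2 := hsum.trans (sum_le_of_served_subset (Finset.Subset.refl _) hx.1)
    have h3 : s + 1 ≤ #(served x) := by exact_mod_cast le_of_mul_le_mul_right h2 hq0
    omega

/-! ### Monotonicity forces the secret to be revealed -/

variable {s : ℕ} {c δ : ℝ} {P R W : Finset (Fin n)}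

/-- At the secret valuation vector only allocations to the secret agents have enough welfare. -/
theorem prob_revealing_base (hQ : ∀ a ∈ Q, 0 ≤ a) (h0 : (0 : ℝ) ∈ Q) (hq : q ∈ Q) (hq0 : 0 < q)
    (hl : 0 < l) (hlh : l < h) (hc : 0 < c)
    (hs : s + 1 ≤ #P) (hPR : h * #P < c * l * #R)
    (T : (Fin n → ({l, h} : Set ℝ)) → Procedure {l, h} Q n)
    (hfeas : ∀ v, (T v).prob (hiddenInstance hQ h0 hq l h s P R W)
      (hiddenInstance hQ h0 hq l h s P R W).feas = 1)
    (hwel : ∀ v, 1 - δ ≤ (T v).prob (hiddenInstance hQ h0 hq l h s P R W)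
      {x | c * welfare v ((hiddenInstance hQ h0 hq l h s P R W).alg v) ≤ welfare v x}) :
    1 - δ ≤ (T (highOn l h W)).prob (hiddenInstance hQ h0 hq l h s P R W) (revealing q s R) := by
  refine (hwel _).trans (Procedure.expect_mono_of_prob_eq_one _ ?_ _ (hfeas _))
  intro x hx
  by_cases hw : c * welfare (highOn l h W)
      ((hiddenInstance hQ h0 hq l h s P R W).alg (highOn l h W)) ≤ welfare (highOn l h W) x
  swap
  · rw [Set.indicator_of_notMem (by exact hw)]
    exact Set.indicator_nonneg (fun _ _ => zero_le_one) x
  suffices hrev : x ∈ revealing q s R by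
    rw [Set.indicator_of_mem hrev]
    exact Set.indicator_le_self' (fun _ _ => zero_le_one) x
  have h1 : (hiddenInstance hQ h0 hq l h s P R W).alg (highOn l h W) = giveTo h0 hq R :=
    if_pos rfl
  rw [h1] at hw
  have h2 := mul_le_mul_of_nonneg_left (le_welfare_giveTo h0 hq hq0 hlh W R) hc.le
  have h3 := welfare_le hQ hlh W x
  have h4 : h * (#P * q) < h * ∑ i, (x i : ℝ) := by nlinarith
  have h5 : #P * q < ∑ i, (x i : ℝ) := lt_of_mul_lt_mul_left h4 (hl.trans hlh).le
  refine mem_revealing hq0 hx (fun hP => ?_) (le_trans ?_ h5.le)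
  · exact absurd (sum_le_of_served_subset hP hx.1) (not_le.2 h5)
  · gcongr
    exact_mod_cast hs

/-- If at a valuation vector with some low agents in `R` a revealing allocation is returned with
probability `g`, then one of these agents receives an amount of at least `g * q / #R` in
expectation. By monotonicity it still does when its valuation is high, and then the welfare of the
decoy can be reached only by a revealing allocation. -/
theorem exists_insert_prob_revealing (hQ : ∀ a ∈ Q, 0 ≤ a) (h0 : (0 : ℝ) ∈ Q) (hq : q ∈ Q)
    (hq0 : 0 < q) (hl : 0 < l) (hlh : l < h) (hc : 0 < c) (hPd : Disjoint P R)
    (hs : h * (s + 1) ≤ c * l * #P) (hsR : s < #R)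
    (T : (Fin n → ({l, h} : Set ℝ)) → Procedure {l, h} Q n)
    (hfeas : ∀ v, (T v).prob (hiddenInstance hQ h0 hq l h s P R W)
      (hiddenInstance hQ h0 hq l h s P R W).feas = 1)
    (hmono : ∀ v i b, v i ≤ b →
      (T v).expect (hiddenInstance hQ h0 hq l h s P R W) (fun x => (x i : ℝ)) ≤
      (T (Function.update v i b)).expect (hiddenInstance hQ h0 hq l h s P R W)
        (fun x => (x i : ℝ)))
    (hwel : ∀ v, 1 - δ ≤ (T v).prob (hiddenInstance hQ h0 hq l h s P R W)
      {x | c * welfare v ((hiddenInstance hQ h0 hq l h s P R W).alg v) ≤ welfare v x})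
    (U : Finset (Fin n)) (hUR : U ⊆ R) (hU : #U ≤ s) (hWR : Disjoint W R) :
    ∃ u ∈ R, u ∉ U ∧
      (T (highOn l h (W ∪ U))).prob (hiddenInstance hQ h0 hq l h s P R W) (revealing q s R) / #R
        - δ ≤ (T (highOn l h (W ∪ insert u U))).prob (hiddenInstance hQ h0 hq l h s P R W)
          (revealing q s R) := by
  set I := hiddenInstance hQ h0 hq l h s P R W with hI
  set v := highOn l h (W ∪ U) with hv
  set g := (T v).prob I (revealing q s R) with hg
  have hR0 : (0 : ℝ) < #R := by exact_mod_cast (by omega : 0 < #R)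
  -- A revealing allocation gives at least `q` to the agents outside of `U`, since `#U ≤ s`.
  have hsum : g * q ≤ ∑ u ∈ R \ U, (T v).expect I (fun x => (x u : ℝ)) := by
    rw [← Procedure.expect_sum, hg, Procedure.prob, mul_comm, ← Procedure.expect_const_mul]
    refine Procedure.expect_mono I (fun x => ?_) _
    by_cases hx : x ∈ revealing q s R
    · rw [Set.indicator_of_mem hx, Pi.one_apply, mul_one]
      have h1 : ∑ i ∈ U, (x i : ℝ) ≤ s * q := by
        calc ∑ i ∈ U, (x i : ℝ) ≤ #U * q := by
              simpa using Finset.sum_le_card_nsmul U (fun i => (x i : ℝ)) q fun i _ => hx.1 i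
          _ ≤ s * q := by gcongr
      have h2 : ∑ i ∈ R, (x i : ℝ) = ∑ i, (x i : ℝ) :=
        Finset.sum_subset (Finset.subset_univ R) fun i _ hi => by
          by_contra h3; exact hi (hx.2.1 (mem_served.2 h3))
      have h3 := Finset.sum_sdiff (f := fun i => (x i : ℝ)) hUR
      have h4 := hx.2.2
      linarith
    · rw [Set.indicator_of_notMem hx, mul_zero]
      exact Finset.sum_nonneg fun i _ => hQ _ (x i).2
  have hg0 : 0 ≤ g := Procedure.prob_nonneg _ _ _
  obtain ⟨u, hu, hgu⟩ : ∃ u ∈ R \ U, g * q / #R ≤ (T v).expect I (fun x => (x u : ℝ)) := by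
    have hcard : 0 < #(R \ U) := by
      have := Finset.le_card_sdiff U R
      omega
    refine Finset.exists_le_of_sum_le (Finset.card_pos.1 hcard) (le_trans ?_ hsum)
    rw [Finset.sum_const, nsmul_eq_mul, mul_div_assoc', div_le_iff₀ hR0, mul_comm]
    gcongr
    exact Finset.sdiff_subset
  rw [Finset.mem_sdiff] at hu
  refine ⟨u, hu.1, hu.2, ?_⟩
  have huW : u ∉ W := fun hW => Finset.disjoint_left.1 hWR hW hu.1
  have huV : u ∉ W ∪ U := by simp [huW, hu.2]
  set v' := highOn l h (W ∪ insert u U) with hv'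
  have hvv : v' = Function.update v u ⟨h, by simp⟩ := by
    rw [hv', Finset.union_insert, highOn_insert]
  have hmon : (T v).expect I (fun x => (x u : ℝ)) ≤ (T v').expect I (fun x => (x u : ℝ)) := by
    rw [hvv]
    refine hmono _ _ _ ?_
    rw [← Subtype.coe_le_coe, hv, highOn_val, if_neg huV]
    exact hlh.le
  have halg : I.alg v' = giveTo h0 hq P := by
    refine if_neg fun h1 => huW ?_
    rw [← highOn_injective hlh h1]
    simp
  set w := (T v').prob I {x | c * welfare v' (I.alg v') ≤ welfare v' x} with hw
  set g' := (T v').prob I (revealing q s R) with hg'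
  -- Agent `u` receives something only if the allocation is revealing or has too little welfare.
  have hle : (T v').expect I (fun x => (x u : ℝ)) ≤ q * (g' + (1 + (-1) * w)) := by
    have hlin : q * (g' + (1 + (-1) * w)) = (T v').expect I (fun x =>
        q * ((revealing q s R).indicator 1 x +
          (1 + (-1) * {x | c * welfare v' (I.alg v') ≤ welfare v' x}.indicator 1 x))) := by
      rw [Procedure.expect_const_mul, Procedure.expect_add, Procedure.expect_add,
        Procedure.expect_const_mul, Procedure.expect_const]
      rfl
    rw [hlin]
    refine Procedure.expect_mono_of_prob_eq_one I (S := I.feas) (fun x hx => ?_) _ (hfeas _)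
    by_cases hxw : c * welfare v' (I.alg v') ≤ welfare v' x
    · rw [Set.indicator_of_mem (s := {x | c * welfare v' (I.alg v') ≤ welfare v' x}) hxw]
      by_cases hxu : (x u : ℝ) = 0
      · have h1 : 0 ≤ (revealing q s R).indicator (1 : (Fin n → Q) → ℝ) x :=
          Set.indicator_nonneg (fun _ _ => zero_le_one) x
        rw [hxu, Pi.one_apply]
        have := mul_nonneg hq0.le h1
        linarith
      · have hrev : x ∈ revealing q s R := by
          refine mem_revealing hq0 hx (fun hP => ?_) ?_
          · exact Finset.disjoint_left.1 hPd (hP (mem_served.2 hxu)) hu.1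
          · rw [halg] at hxw
            have h2 := mul_le_mul_of_nonneg_left
              (le_welfare_giveTo h0 hq hq0 hlh (W ∪ insert u U) P) hc.le
            have h3 := welfare_le hQ hlh (W ∪ insert u U) x
            have h4 := mul_le_mul_of_nonneg_right hs hq0.le
            refine le_of_mul_le_mul_left ?_ (hl.trans hlh)
            linarith
        rw [Set.indicator_of_mem hrev, Pi.one_apply]
        linarith [hx.1 u]
    · rw [Set.indicator_of_notMem (s := {x | c * welfare v' (I.alg v') ≤ welfare v' x}) hxw]
      have h1 : 0 ≤ (revealing q s R).indicator (1 : (Fin n → Q) → ℝ) x :=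
        Set.indicator_nonneg (fun _ _ => zero_le_one) x
      have := mul_nonneg hq0.le h1
      linarith [hx.1 u]
  have hw1 : 1 - δ ≤ w := hwel v'
  have h1 : q * (g / #R) ≤ q * (g' + δ) := by
    calc q * (g / #R) = g * q / #R := by ring
      _ ≤ q * (g' + (1 + (-1) * w)) := hgu.trans (hmon.trans hle)
      _ ≤ q * (g' + δ) := by gcongr; linarith
  linarith [le_of_mul_le_mul_left h1 hq0]

/-- Iterating the previous step from the secret valuation vector. -/
theorem exists_subset_prob_revealing (hQ : ∀ a ∈ Q, 0 ≤ a) (h0 : (0 : ℝ) ∈ Q) (hq : q ∈ Q)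
    (hq0 : 0 < q) (hl : 0 < l) (hlh : l < h) (hc : 0 < c) (hPd : Disjoint P R)
    (hδ : 0 ≤ δ) (hsP : s + 1 ≤ #P) (hPR : h * #P < c * l * #R)
    (hs : h * (s + 1) ≤ c * l * #P) (hsR : s < #R)
    (T : (Fin n → ({l, h} : Set ℝ)) → Procedure {l, h} Q n)
    (hfeas : ∀ v, (T v).prob (hiddenInstance hQ h0 hq l h s P R W)
      (hiddenInstance hQ h0 hq l h s P R W).feas = 1)
    (hmono : ∀ v i b, v i ≤ b →
      (T v).expect (hiddenInstance hQ h0 hq l h s P R W) (fun x => (x i : ℝ)) ≤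
      (T (Function.update v i b)).expect (hiddenInstance hQ h0 hq l h s P R W)
        (fun x => (x i : ℝ)))
    (hwel : ∀ v, 1 - δ ≤ (T v).prob (hiddenInstance hQ h0 hq l h s P R W)
      {x | c * welfare v ((hiddenInstance hQ h0 hq l h s P R W).alg v) ≤ welfare v x})
    (hWR : Disjoint W R) (j : ℕ) (hj : j ≤ s) :
    ∃ U ⊆ R, #U = j ∧ ((#R : ℝ)⁻¹) ^ j - (j + 1) * δ ≤
      (T (highOn l h (W ∪ U))).prob (hiddenInstance hQ h0 hq l h s P R W)
        (revealing q s R) := by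
  induction j with
  | zero =>
    refine ⟨∅, by simp, by simp, ?_⟩
    have := prob_revealing_base hQ h0 hq hq0 hl hlh hc hsP hPR T hfeas hwel
    simpa using this
  | succ j ih =>
    obtain ⟨U, hUR, hU, hg⟩ := ih (by omega)
    obtain ⟨u, huR, huU, h1⟩ := exists_insert_prob_revealing hQ h0 hq hq0 hl hlh hc hPd hs hsR T
      hfeas hmono hwel U hUR (by omega) hWR
    refine ⟨insert u U, Finset.insert_subset huR hUR, by simp [huU, hU], le_trans ?_ h1⟩
    have hR1 : ((#R : ℝ)⁻¹) ≤ 1 := inv_le_one_of_one_le₀ (by exact_mod_cast (by omega : 1 ≤ #R))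
    have hR0 : 0 ≤ ((#R : ℝ)⁻¹) := by positivity
    have h2 := mul_le_mul_of_nonneg_right hg hR0
    have h3 : (j + 1) * δ * (#R : ℝ)⁻¹ ≤ (j + 1) * δ := mul_le_of_le_one_right (by positivity) hR1
    rw [div_eq_mul_inv, pow_succ]
    push_cast
    linarith

end HiddenInstance

/-! ### Counting secrets -/

section Counting

variable {r b n s : ℕ} {e : Fin r × Fin b → Fin n}

/-- The agents that the choice function `f` selects from the blocks in `S`. Here `e (t, a)` is
agent number `a` of block `t`. -/
def selected (e : Fin r × Fin b → Fin n) (f : Fin r → Fin b) (S : Finset (Fin r)) :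
    Finset (Fin n) :=
  S.image fun t => e (t, f t)

theorem mem_selected_iff (he : Function.Injective e) {f : Fin r → Fin b} {S : Finset (Fin r)}
    {t : Fin r} {a : Fin b} : e (t, a) ∈ selected e f S ↔ t ∈ S ∧ f t = a := by
  simp only [selected, Finset.mem_image, he.eq_iff, Prod.mk.injEq]
  constructor
  · rintro ⟨t', ht', rfl, rfl⟩; exact ⟨ht', rfl⟩
  · rintro ⟨ht, rfl⟩; exact ⟨t, ht, rfl, rfl⟩

theorem card_selected (he : Function.Injective e) (f : Fin r → Fin b) (S : Finset (Fin r)) :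
    #(selected e f S) = #S :=
  Finset.card_image_of_injective _ fun _ _ h => (Prod.mk.inj (he h)).1

theorem selected_mono (f : Fin r → Fin b) {S S' : Finset (Fin r)} (h : S ⊆ S') :
    selected e f S ⊆ selected e f S' :=
  Finset.image_subset_image h

theorem card_le_of_agree (hb : 0 < b) {B : Finset (Fin r → Fin b)} {T : Finset (Fin r)}
    (hT : s ≤ #T) (hB : ∀ f ∈ B, ∀ f' ∈ B, ∀ t ∈ T, f t = f' t) : #B ≤ b ^ (r - s) := by
  calc #B ≤ Fintype.card ({t // t ∉ T} → Fin b) := by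
        refine Finset.card_le_card_of_injOn (t := Finset.univ)
          (fun f (t : {t // t ∉ T}) => f t) (fun _ _ => Finset.mem_univ _) ?_
        intro f hf f' hf' h
        ext t
        by_cases ht : t ∈ T
        · rw [hB f hf f' hf' t ht]
        · rw [show f t = f' t from congrFun h ⟨t, ht⟩]
    _ = b ^ (r - #T) := by simp [Fintype.card_subtype_compl]
    _ ≤ b ^ (r - s) := Nat.pow_le_pow_right hb (by omega)

theorem card_le_of_subset_selected (he : Function.Injective e) (hb : 0 < b)
    {B : Finset (Fin r → Fin b)} {X : Finset (Fin n)} (hX : s ≤ #X)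
    (hB : ∀ f ∈ B, X ⊆ selected e f univ) : #B ≤ b ^ (r - s) := by
  rcases B.eq_empty_or_nonempty with rfl | ⟨f₀, hf₀⟩
  · simp
  refine card_le_of_agree (T := {t | e (t, f₀ t) ∈ X}) hb (hX.trans ?_) ?_
  · rw [← card_selected he f₀]
    refine Finset.card_le_card fun i hi => ?_
    obtain ⟨t, -, rfl⟩ := Finset.mem_image.1 (hB f₀ hf₀ hi)
    exact (mem_selected_iff he).2 ⟨by simpa using hi, rfl⟩
  · intro f hf f' hf' t ht
    rw [Finset.mem_filter] at ht
    rw [((mem_selected_iff he).1 (hB f hf ht.2)).2, ((mem_selected_iff he).1 (hB f' hf' ht.2)).2]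

/-- Replacing the part in `R` of a uniformly random set by `U` produces no set with more than
`2 ^ #R` times its original probability. -/
theorem sum_replace_le {R U : Finset (Fin n)} (hUR : U ⊆ R) (H : Finset (Fin n) → ℝ)
    (hH : ∀ A, 0 ≤ H A) :
    ∑ Z, H ((Z \ R) ∪ U) ≤ 2 ^ #R * ∑ A with U ⊆ A, H A := by
  have hmaps : ∀ Z ∈ (univ : Finset (Finset (Fin n))),
      (Z \ R) ∪ U ∈ ({A | U ⊆ A} : Finset (Finset (Fin n))) := by
    intro Z _
    simp
  rw [← Finset.sum_fiberwise_of_maps_to hmaps, Finset.mul_sum]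
  refine Finset.sum_le_sum fun A hA => ?_
  rw [Finset.sum_congr rfl fun Z hZ => by rw [(Finset.mem_filter.1 hZ).2],
    Finset.sum_const, nsmul_eq_mul]
  refine mul_le_mul_of_nonneg_right ?_ (hH A)
  have hfib : #{Z : Finset (Fin n) | (Z \ R) ∪ U = A} ≤ #R.powerset := by
    refine Finset.card_le_card_of_injOn (· ∩ R)
      (fun Z _ => Finset.mem_powerset.2 Finset.inter_subset_right) ?_
    intro Z hZ Z' hZ' h
    have h1 : (Z \ R) ∪ U = (Z' \ R) ∪ U :=
      (Finset.mem_filter.1 hZ).2.trans (Finset.mem_filter.1 hZ').2.symm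
    ext i
    have h2 := Finset.ext_iff.1 h i
    have h3 := Finset.ext_iff.1 h1 i
    have h4 := @hUR i
    simp only [Finset.mem_inter, Finset.mem_union, Finset.mem_sdiff] at h2 h3
    tauto
  rw [Finset.card_powerset] at hfib
  exact_mod_cast hfib

end Counting

/-! ### The secret stays hidden -/

section Bound

variable {l h q : ℝ} {Q : Set ℝ} {r b n s : ℕ} {e : Fin r × Fin b → Fin n} {P : Finset (Fin n)}

/-- Let the high set be `A`, and let the secret transversal range over those whose selection from the
blocks in `S` is high. Then a procedure with few steps returns a revealing allocation for few of
them: to separate a hidden instance from the reference instance, a query has to be at the secret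
valuation vector, which determines the selection from `S`, or at an allocation that serves more than
`s` agents, all of them secret. -/
theorem sum_prob_revealing_le (hQ : ∀ a ∈ Q, 0 ≤ a) (h0 : (0 : ℝ) ∈ Q) (hq : q ∈ Q)
    (hq0 : 0 < q) (hlh : l < h) (he : Function.Injective e) (hb : 0 < b)
    {S : Finset (Fin r)} (hS : #S = s) (A : Finset (Fin n)) (p : Procedure {l, h} Q n) (N : ℕ)
    (hN : ∀ I, p.steps I ≤ N) :
    ∑ f with selected e f S ⊆ A,
      p.prob (hiddenInstance hQ h0 hq l h s P (selected e f univ) (A \ selected e f univ))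
        (revealing q s (selected e f univ)) ≤ (N + 1) * (b : ℝ) ^ (r - s) := by
  refine Procedure.sum_prob_le (hiddenInstance hQ h0 hq l h s P P ∅) _ _ (by positivity) p _
    ?_ ?_ ?_ N (hN _)
  · intro x B _ hB
    rcases B.eq_empty_or_nonempty with rfl | ⟨f, hf⟩
    · simp
    exact_mod_cast card_le_of_subset_selected he hb (lt_card_served hq0 (hB f hf)).le
      fun f hf => (hB f hf).2.1
  · intro v B hBA hB
    have hv : ∀ f ∈ B, v = highOn l h (A \ selected e f univ) := by
      intro f hf
      by_contra hne
      refine hB f hf ?_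
      simp [hiddenInstance, hne]
    have hagree : ∀ f ∈ B, ∀ f' ∈ B, ∀ t ∈ S, f t = f' t := by
      intro f hf f' hf' t ht
      have h1 := highOn_injective hlh ((hv f hf).symm.trans (hv f' hf'))
      have h2 : e (t, f t) ∈ A :=
        (Finset.mem_filter.1 (hBA hf)).2 ((mem_selected_iff he).2 ⟨ht, rfl⟩)
      have h3 : e (t, f t) ∉ A \ selected e f univ := by
        simp [mem_selected_iff he]
      rw [h1, Finset.mem_sdiff, not_and, not_not] at h3
      exact ((mem_selected_iff he).1 (h3 h2)).2.symm
    exact_mod_cast card_le_of_agree hb hS.ge hagree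
  · intro x B _ hB
    have hx : ∀ f ∈ B, s ≤ #(served x) ∧ served x ⊆ selected e f univ := by
      intro f hf
      have h1 := hB f hf
      simp only [hiddenInstance, Set.mem_ofPred_eq] at h1
      by_cases h2 : #(served x) ≤ s
      · tauto
      · exact ⟨by omega, by tauto⟩
    rcases B.eq_empty_or_nonempty with rfl | ⟨f, hf⟩
    · simp
    exact_mod_cast card_le_of_subset_selected he hb (hx f hf).1 fun f hf => (hx f hf).2

/-- The forced and the possible probabilities of revealing allocations, summed over all secret
transversals and all sets of agents with high valuations. -/
theorem mul_pow_le_of_monotone {c δ : ℝ} (hQ : ∀ a ∈ Q, 0 ≤ a) (h0 : (0 : ℝ) ∈ Q) (hq : q ∈ Q)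
    (hq0 : 0 < q) (hl : 0 < l) (hlh : l < h) (hc : 0 < c) (hδ : 0 ≤ δ)
    (he : Function.Injective e) (hb : 0 < b) (hPe : ∀ x, e x ∉ P)
    (hsP : s + 1 ≤ #P) (hPR : h * #P < c * l * r) (hs : h * (s + 1) ≤ c * l * #P) (hsr : s < r)
    (T : (Fin n → ({l, h} : Set ℝ)) → Procedure {l, h} Q n) (N : ℕ)
    (hN : ∀ I v, (T v).steps I ≤ N)
    (hfeas : ∀ I v, (T v).prob I I.feas = 1)
    (hmono : ∀ I v i b, v i ≤ b → (T v).expect I (fun x => (x i : ℝ)) ≤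
      (T (Function.update v i b)).expect I (fun x => (x i : ℝ)))
    (hwel : ∀ I v, 1 - δ ≤ (T v).prob I {x | c * welfare v (I.alg v) ≤ welfare v x}) :
    (((r : ℝ)⁻¹) ^ s - (s + 1) * δ) * (b : ℝ) ^ s ≤ 4 ^ r * (N + 1) := by
  classical
  set G : Finset (Fin n) → (Fin r → Fin b) → ℝ := fun A f =>
    (T (highOn l h A)).prob
      (hiddenInstance hQ h0 hq l h s P (selected e f univ) (A \ selected e f univ))
      (revealing q s (selected e f univ)) with hG
  have hG0 : ∀ A f, 0 ≤ G A f := fun A f => Procedure.prob_nonneg _ _ _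
  have hlower : ∀ (f : Fin r → Fin b) (Z : Finset (Fin n)),
      ((r : ℝ)⁻¹) ^ s - (s + 1) * δ ≤
        ∑ S ∈ powersetCard s univ, G ((Z \ selected e f univ) ∪ selected e f S) f := by
    intro f Z
    have hcard : #(selected e f univ) = r := by simp [card_selected he]
    have hPd : Disjoint P (selected e f univ) := by
      rw [Finset.disjoint_right]
      intro i hi
      obtain ⟨t, -, rfl⟩ := Finset.mem_image.1 hi
      exact hPe _
    obtain ⟨U, hU, hUs, hg⟩ := exists_subset_prob_revealing (W := Z \ selected e f univ) hQ h0 hq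
      hq0 hl hlh hc hPd hδ hsP (by rwa [hcard]) hs (by rwa [hcard]) T (hfeas _) (hmono _) (hwel _)
      Finset.sdiff_disjoint s le_rfl
    obtain ⟨S, -, rfl⟩ := Finset.subset_image_iff.1 hU
    change #(selected e f S) = s at hUs
    rw [card_selected he] at hUs
    rw [hcard] at hg
    have hsd : ((Z \ selected e f univ) ∪ selected e f S) \ selected e f univ =
        Z \ selected e f univ := by
      have := selected_mono (e := e) f (Finset.subset_univ S)
      rw [Finset.union_sdiff_distrib, Finset.sdiff_eq_empty_iff_subset.2 this, Finset.union_empty,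
        Finset.sdiff_idem]
    have hGS : ((r : ℝ)⁻¹) ^ s - (s + 1) * δ ≤
        G ((Z \ selected e f univ) ∪ selected e f S) f := by
      simp only [hG]
      rw [hsd]
      exact hg
    exact hGS.trans (Finset.single_le_sum
      (f := fun S => G ((Z \ selected e f univ) ∪ selected e f S) f) (fun S _ => hG0 _ _)
      (Finset.mem_powersetCard.2 ⟨Finset.subset_univ S, hUs⟩))
  have hupper : ∀ S ∈ powersetCard s (univ : Finset (Fin r)),
      ∑ f, ∑ Z, G ((Z \ selected e f univ) ∪ selected e f S) f ≤
        2 ^ r * (2 ^ n * ((N + 1) * (b : ℝ) ^ (r - s))) := by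
    intro S hS
    calc ∑ f, ∑ Z, G ((Z \ selected e f univ) ∪ selected e f S) f
        ≤ ∑ f, 2 ^ r * ∑ A with selected e f S ⊆ A, G A f := by
          refine Finset.sum_le_sum fun f _ => ?_
          have := sum_replace_le (selected_mono (e := e) f (Finset.subset_univ S)) (G · f)
            (hG0 · f)
          rwa [card_selected he, Finset.card_fin] at this
      _ = 2 ^ r * ∑ A, ∑ f with selected e f S ⊆ A, G A f := by
          rw [← Finset.mul_sum]
          simp only [Finset.sum_filter]
          rw [Finset.sum_comm]
      _ ≤ 2 ^ r * ∑ A : Finset (Fin n), (N + 1) * (b : ℝ) ^ (r - s) := by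
          gcongr with A
          exact sum_prob_revealing_le hQ h0 hq hq0 hlh he hb (Finset.mem_powersetCard.1 hS).2 A _ N
            fun I => hN I _
      _ = 2 ^ r * (2 ^ n * ((N + 1) * (b : ℝ) ^ (r - s))) := by
          simp
  have htotal : (b : ℝ) ^ r * (2 ^ n * (((r : ℝ)⁻¹) ^ s - (s + 1) * δ)) ≤
      2 ^ r * (2 ^ r * (2 ^ n * ((N + 1) * (b : ℝ) ^ (r - s)))) := by
    calc (b : ℝ) ^ r * (2 ^ n * (((r : ℝ)⁻¹) ^ s - (s + 1) * δ))
        = ∑ f : Fin r → Fin b, ∑ Z : Finset (Fin n), (((r : ℝ)⁻¹) ^ s - (s + 1) * δ) := by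
          simp only [Finset.sum_const, nsmul_eq_mul, Finset.card_univ, Fintype.card_finset,
            Fintype.card_pi, Fintype.card_fin, Finset.prod_const]
          push_cast
          ring
      _ ≤ ∑ f : Fin r → Fin b, ∑ Z : Finset (Fin n),
            ∑ S ∈ powersetCard s univ, G ((Z \ selected e f univ) ∪ selected e f S) f :=
          Finset.sum_le_sum fun f _ => Finset.sum_le_sum fun Z _ => hlower f Z
      _ = ∑ S ∈ powersetCard s univ, ∑ f, ∑ Z,
            G ((Z \ selected e f univ) ∪ selected e f S) f := by
          rw [Finset.sum_comm (s := powersetCard s univ)]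
          exact Finset.sum_congr rfl fun f _ => Finset.sum_comm
      _ ≤ ∑ S ∈ powersetCard s (univ : Finset (Fin r)),
            2 ^ r * (2 ^ n * ((N + 1) * (b : ℝ) ^ (r - s))) := Finset.sum_le_sum hupper
      _ ≤ 2 ^ r * (2 ^ r * (2 ^ n * ((N + 1) * (b : ℝ) ^ (r - s)))) := by
          rw [Finset.sum_const, nsmul_eq_mul, Finset.card_powersetCard, Finset.card_fin]
          gcongr
          exact_mod_cast Nat.choose_le_two_pow r s
  have hbr : (b : ℝ) ^ r = b ^ s * b ^ (r - s) := by
    rw [← pow_add]; congr 1; omega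
  have hpos : (0 : ℝ) < 2 ^ n * b ^ (r - s) := by positivity
  have h4 : (4 : ℝ) ^ r = 2 ^ r * 2 ^ r := by rw [← mul_pow]; norm_num
  refine le_of_mul_le_mul_right ?_ hpos
  rw [hbr] at htotal
  rw [h4]
  linarith

end Bound

/-! ### Choice of the parameters -/

theorem tendsto_eval_linear_div_pow (p : Polynomial ℕ) (k r : ℕ) :
    Filter.Tendsto (fun b : ℕ => ((p.eval (k + r * b) : ℕ) + 1 : ℝ) / (b : ℝ) ^ (p.natDegree + 1))
      Filter.atTop (nhds 0) := by
  set P : Polynomial ℝ := (p.map (Nat.castRingHom ℝ)).comp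
    (Polynomial.C (k : ℝ) + Polynomial.C (r : ℝ) * Polynomial.X) + 1 with hP
  have hdeg : P.natDegree ≤ p.natDegree := by
    refine (Polynomial.natDegree_add_le _ _).trans (max_le ?_ (by simp))
    refine Polynomial.natDegree_comp_le.trans ?_
    calc _ ≤ p.natDegree * 1 := by
          gcongr
          · exact Polynomial.natDegree_map_le
          · compute_degree
      _ = _ := mul_one _
  have hlt : P.degree < (Polynomial.X ^ (p.natDegree + 1) : Polynomial ℝ).degree := by
    rw [Polynomial.degree_X_pow]
    exact (Polynomial.degree_le_of_natDegree_le hdeg).trans_lt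
      (by exact_mod_cast Nat.lt_succ_self _)
  have h := (Polynomial.div_tendsto_atTop_zero_of_degree_lt P _ hlt).comp
    (tendsto_natCast_atTop_atTop (R := ℝ))
  refine h.congr fun b => ?_
  have h1 : ((p.eval (k + r * b) : ℕ) : ℝ) =
      (p.map (Nat.castRingHom ℝ)).eval ((k : ℝ) + r * b) := by
    have := Polynomial.eval_natCast_map (Nat.castRingHom ℝ) p (k + r * b)
    push_cast at this
    exact this.symm
  simp [hP, h1]

/-- Let `l n < h n` be positive with a constant ratio `ρ`, and let the amounts of stuff be taken
from a set `Q` of nonnegative reals that contains `0` and a positive number.  There is no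
transformation with polynomially many steps (in particular, none that runs in polynomial time)
that is monotone and constant-fraction welfare-preserving. -/
theorem theorem2 (l h : ℕ → ℝ) (hl : ∀ n, 0 < l n) (hlh : ∀ n, l n < h n)
    (ρ : ℝ) (hρ : ∀ n, h n / l n = ρ)
    (Q : Set ℝ) (hQ : ∀ q ∈ Q, 0 ≤ q) (hQ_zero : (0 : ℝ) ∈ Q) (hQ_pos : ∃ q ∈ Q, 0 < q) :
    ¬ ∃ T : Transformation (fun n => {l n, h n}) Q,
      T.IsFeasible ∧ T.IsPolynomial ∧ T.IsMonotone ∧ T.PreservesConstantFraction := by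
  rintro ⟨T, hfeas, ⟨p, hp⟩, hmono, c, hc, δ, hδ, hwel⟩
  obtain ⟨q, hq, hq0⟩ := hQ_pos
  have hh : ∀ n, h n = ρ * l n := fun n => by rw [← hρ n, div_mul_cancel₀ _ (hl n).ne']
  set s := p.natDegree + 1 with hs
  obtain ⟨k, hk1, hk2⟩ : ∃ k : ℕ, s + 1 ≤ k ∧ ρ * (s + 1) ≤ c * k := by
    obtain ⟨k, hk⟩ := exists_nat_ge (ρ * (s + 1) / c)
    refine ⟨max k (s + 1), le_max_right _ _, ?_⟩
    rw [div_le_iff₀ hc, mul_comm (k : ℝ)] at hk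
    refine hk.trans (mul_le_mul_of_nonneg_left ?_ hc.le)
    exact_mod_cast le_max_left _ _
  obtain ⟨r, hr1, hr2⟩ : ∃ r : ℕ, s < r ∧ ρ * k < c * r := by
    obtain ⟨r, hr⟩ := exists_nat_gt (ρ * k / c)
    refine ⟨max r (s + 1), lt_of_lt_of_le (Nat.lt_succ_self s) (le_max_right _ _), ?_⟩
    rw [div_lt_iff₀ hc, mul_comm (r : ℝ)] at hr
    refine hr.trans_le (mul_le_mul_of_nonneg_left ?_ hc.le)
    exact_mod_cast le_max_left _ _
  have hr0 : 0 < r := by omega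
  -- With `k` decoys and `r` blocks of `b` agents each, the bound below fails for large `b`.
  have hbound : ∀ b : ℕ, 0 < b → ((r : ℝ)⁻¹) ^ s - (s + 1) * |δ (k + r * b)| ≤
      4 ^ r * (((p.eval (k + r * b) : ℕ) + 1) / (b : ℝ) ^ s) := by
    intro b hb
    have hn := hl (k + r * b)
    have hmain := mul_pow_le_of_monotone (s := s) (r := r) (b := b) (n := k + r * b)
      (e := fun x => Fin.natAdd k (finProdFinEquiv x))
      (P := univ.image (Fin.castAdd (r * b) : Fin k → _)) hQ hQ_zero hq hq0 hn (hlh _) hc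
      (abs_nonneg (δ (k + r * b)))
      (fun x y hxy => finProdFinEquiv.injective (Fin.natAdd_injective _ _ hxy)) hb
      (by
        intro x hx
        obtain ⟨i, -, hi⟩ := Finset.mem_image.1 hx
        have h1 := congrArg Fin.val hi
        simp only [Fin.val_castAdd, Fin.val_natAdd] at h1
        have := i.2
        omega)
    rw [Finset.card_image_of_injective _ (Fin.castAdd_injective _ _), Finset.card_fin] at hmain
    have h1 := hmain hk1
      (by rw [hh]; nlinarith) (by rw [hh]; nlinarith) hr1 (T (k + r * b))
      (p.eval (k + r * b)) (fun I v => hp _ I v) (fun I v => hfeas _ I v)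
      (fun I v i b hb => hmono _ I v i b hb)
      (fun I v => le_trans (by linarith [le_abs_self (δ (k + r * b))]) (hwel _ I v))
    rw [mul_div_assoc', le_div_iff₀ (by positivity)]
    exact h1
  have hsize : Filter.Tendsto (fun b : ℕ => k + r * b) Filter.atTop Filter.atTop :=
    Filter.tendsto_atTop_mono 
      (fun b => (Nat.le_mul_of_pos_left b hr0).trans (Nat.le_add_left _ _)) Filter.tendsto_id
  have hL : Filter.Tendsto (fun b : ℕ => ((r : ℝ)⁻¹) ^ s - (s + 1) * |δ (k + r * b)|)
      Filter.atTop (nhds (((r : ℝ)⁻¹) ^ s)) := by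
    simpa using tendsto_const_nhds.sub (((hδ.comp hsize).abs).const_mul ((s : ℝ) + 1))
  have hR : Filter.Tendsto (fun b : ℕ => (4 : ℝ) ^ r * (((p.eval (k + r * b) : ℕ) + 1) /
      (b : ℝ) ^ s)) Filter.atTop (nhds 0) := by
    simpa using (tendsto_eval_linear_div_pow p k r).const_mul ((4 : ℝ) ^ r)
  have hle : ((r : ℝ)⁻¹) ^ s ≤ 0 :=
    le_of_tendsto_of_tendsto hL hR ((Filter.eventually_gt_atTop 0).mono hbound)
  have : (0 : ℝ) < ((r : ℝ)⁻¹) ^ s := by positivity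
  linarith
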